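/- All shift spaces are two-sided, over finite alphabets, with shift map $\sigma$; measures are Borel probability measures. Let $X$ be an irreducible sofic shift, let $\pi : X \to Y$ be a finite-to-one factor code onto a shift space $Y$ (a continuous shift-commuting surjection with finite fibers), and let $d_\pi$ be its degree, i.e. the number such that every doubly transitive point of $Y$ (a point in which every word occurring in $Y$ appears infinitely often to the left and to the right) has exactly $d_\pi$ preimages. Let $\nu$ be a fully supported ergodic measure on $Y$. For $n \ge 1$, an $n$-fold relative joining over $\nu$ is a $\sigma\times\cdots\times\sigma$-invariant measure $\lambda$ on $X^n$ such that $\pi(x_1) = \cdots = \pi(x_n)$ for $\lambda$-a.e. $(x_1,\dots,x_n)$ and such that the image of $\lambda$ under $(x_1,\dots,x_n) \mapsto \pi(x_i)$ is $\nu$ for some (equivalently, every) $i$. It is separating if $x_1,\dots,x_n$ are pairwise distinct for $\lambda$-a.e. $(x_1,\dots,x_n)$. A degree joining over $\nu$ is an ergodic separating $d_\pi$-fold relative joining over $\nu$. For $f : \{1,\dots,n\} \to \{1,\dots,d_\pi\}$, let $p_f : X^{d_\pi} \to X^n$, $p_f(x_1,\dots,x_{d_\pi}) = (x_{f(1)},\dots,x_{f(n)})$,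 and let $p_f\lambda$ denote the pushforward of $\lambda$ under $p_f$. (1) If $\lambda$ is a degree joining over $\nu$ and $\lambda'$ is an $n$-fold ergodic relative joining over $\nu$, then there is a function $f : \{1,\dots,n\} \to \{1,\dots,d_\pi\}$ such that $\lambda' = p_f \lambda$. (2) If $\lambda$ and $\lambda'$ are degree joinings over $\nu$, then there is a permutation $f$ of $\{1,\dots,d_\pi\}$ such that $\lambda' = p_f\lambda$. -/

import Mathlib

open MeasureTheory SymbolicDynamics.FullShift

namespace DegreeJoining

section Shifts

/-- The word `w` occurs in the bi-infinite sequence `x` starting at coordinate `i`. -/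
def OccursAt {A : Type*} (w : List A) (x : ℤ → A) (i : ℤ) : Prop :=
  ∀ (j : ℕ) (hj : j < w.length), x (i + j) = w[j]

/-- The language of a (two-sided) shift space: all finite words occurring in its points. -/
def language {A : Type*} [TopologicalSpace A] (X : Subshift A ℤ) : Set (List A) :=
  {w | ∃ x ∈ X.carrier, ∃ i : ℤ, OccursAt w x i}

/-- The shift homeomorphism `(σ x) i = x (i + 1)` of a two-sided shift space, as a self-map. -/
def shiftMap {A : Type*} [TopologicalSpace A] (X : Subshift A ℤ) (x : X.carrier) : X.carrier :=
  ⟨shift 1 x.1, X.mapsTo 1 x.2⟩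

/-- Irreducibility: any two words of the language can be joined, in the given order, by a word. -/
def IsIrreducible {A : Type*} [TopologicalSpace A] (X : Subshift A ℤ) : Prop :=
  ∀ u ∈ language X, ∀ v ∈ language X, ∃ w : List A, u ++ w ++ v ∈ language X

/-- Shifts of finite type: given by a finite set of forbidden finite patterns. -/
def IsSFT {A : Type*} [TopologicalSpace A] [Inhabited A] (X : Subshift A ℤ) : Prop :=
  ∃ F : Set (Pattern A ℤ), F.Finite ∧ X.carrier = forbidden F

/-- A factor code: a continuous, shift-commuting, surjective map between shift spaces. -/
structure IsFactorCode {A B : Type*} [TopologicalSpace A] [TopologicalSpace B]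
    {X : Subshift A ℤ} {Y : Subshift B ℤ} (π : X.carrier → Y.carrier) : Prop where
  continuous : Continuous π
  semiconj : Function.Semiconj π (shiftMap X) (shiftMap Y)
  surjective : Function.Surjective π

/-- A sofic shift: the image under a factor code of a shift of finite type over a finite alphabet
(which may be taken to be `{0, …, k}`). -/
def IsSofic {A : Type*} [TopologicalSpace A] (X : Subshift A ℤ) : Prop :=
  ∃ (k : ℕ) (Z : Subshift (Fin (k + 1)) ℤ), IsSFT Z ∧
    ∃ φ : Z.carrier → X.carrier, IsFactorCode φ

/-- A point of a shift space is doubly transitive if every word of the language occurs in it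
infinitely often to the right and infinitely often to the left. -/
def IsDoublyTransitive {A : Type*} [TopologicalSpace A] {X : Subshift A ℤ}
    (x : X.carrier) : Prop :=
  ∀ w ∈ language X, ∀ N : ℤ, (∃ i ≥ N, OccursAt w x.1 i) ∧ (∃ i ≤ N, OccursAt w x.1 i)

/-- A map is finite-to-one if all its fibers are finite. -/
def IsFiniteToOne {α β : Type*} (π : α → β) : Prop :=
  ∀ y : β, (π ⁻¹' {y}).Finite

/-- The degree of a factor code: the number `d` such that every doubly transitive point of `Y` has
exactly `d` preimages. -/
noncomputable def degree {A B : Type*} [TopologicalSpace A] [TopologicalSpace B]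
    {X : Subshift A ℤ} {Y : Subshift B ℤ} (π : X.carrier → Y.carrier) : ℕ :=
  sInf {d : ℕ | ∀ y : Y.carrier, IsDoublyTransitive y → (π ⁻¹' {y}).encard = d}

end Shifts

section Joinings

/-- The map `T × ⋯ × T` on `X^n`. -/
def powMap {X : Type*} (T : X → X) (n : ℕ) (x : Fin n → X) : Fin n → X :=
  fun i => T (x i)

/-- The map `p_f : X^d → X^n`, `(x_1, …, x_d) ↦ (x_{f 1}, …, x_{f n})`, induced by
`f : {1, …, n} → {1, …, d}`. -/
def coordMap {X : Type*} {n d : ℕ} (f : Fin n → Fin d) (x : Fin d → X) : Fin n → X :=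
  fun i => x (f i)

/-- `lam` is an `n`-fold `π`-relative joining over `ν`: a probability measure on `X^n`, invariant
under `T × ⋯ × T`, giving full measure to the set of tuples whose entries have a common image under
`π`, and with `π p_i lam = ν` for some (hence every) `i`. -/
structure IsRelativeJoining {X Y : Type*} [MeasurableSpace X] [MeasurableSpace Y]
    (T : X → X) (π : X → Y) (ν : Measure Y) {n : ℕ} (lam : Measure (Fin n → X)) : Prop where
  prob : IsProbabilityMeasure lam
  invariant : MeasurePreserving (powMap T n) lam lam
  fiber : ∀ᵐ x ∂lam, ∀ i j : Fin n, π (x i) = π (x j)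
  image : ∃ i : Fin n, (lam.map (fun x => x i)).map π = ν

/-- A measure on `X^n` is separating if almost every tuple consists of `n` distinct points. -/
def IsSeparating {X : Type*} [MeasurableSpace X] {n : ℕ} (lam : Measure (Fin n → X)) : Prop :=
  ∀ᵐ x ∂lam, Function.Injective x

/-- A degree joining over `ν` with respect to `π`: an ergodic `d`-fold separating relative joining
over `ν`, where `d` is the degree of `π`. -/
structure IsDegreeJoining {A B : Type*} [TopologicalSpace A] [TopologicalSpace B]
    [MeasurableSpace A] [MeasurableSpace B] {X : Subshift A ℤ} {Y : Subshift B ℤ}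
    (π : X.carrier → Y.carrier) (ν : Measure Y.carrier)
    (lam : Measure (Fin (degree π) → X.carrier)) : Prop where
  joining : IsRelativeJoining (shiftMap X) π ν lam
  ergodic : Ergodic (powMap (shiftMap X) (degree π)) lam
  separating : IsSeparating lam

end Joinings

end DegreeJoining

/-!
Fullness of `ν` and ergodicity force `ν`-almost every point of `Y` to be doubly transitive
(`ae_isDoublyTransitive`), so its `π`-fibre has exactly `d = degree π` points. A separating `d`-fold
relative joining `lam` therefore enumerates the whole fibre: for `lam`-almost every `x`, the fibre
through the entries of `x` is `{x_1, …, x_d}` (`IsDegreeJoining.ae_fiber_subset_range`).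

Consequently every `n`-tuple of points in a common fibre over a typical point of `Y` is of the form
`p_f x`, with `x` typical for `lam`; hence any `n`-fold relative joining `lam'` over `ν` is
absolutely continuous with respect to `∑ f, p_f lam`
(`IsRelativeJoining.absolutelyContinuous_sum_map_coordMap`). The statement about typical points of
`Y` concerns a set which is a continuous image; its measurability is avoided by exhausting a set of
full measure for `lam` by compact sets, whose images are compact.

Each `p_f lam` is ergodic, and two ergodic probability measures are equal or mutually singular
(`Ergodic.eq_or_mutuallySingular`). An ergodic `lam'` cannot be singular to all the `p_f lam`, so it
equals one of them. If moreover `lam'` is separating, then `p_f x` has distinct entries for almost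
every `x`, which makes `f` injective, hence a permutation when `n = d`.
-/

/-- Two ergodic probability measures of the same map are equal or mutually singular: the absolutely
continuous part of one with respect to the other is invariant, hence a constant multiple. -/
theorem Ergodic.eq_or_mutuallySingular {α : Type*} [MeasurableSpace α] {T : α → α}
    {μ ν : Measure α} [IsProbabilityMeasure μ] [IsProbabilityMeasure ν]
    (hμ : Ergodic T μ) (hν : Ergodic T ν) : μ = ν ∨ μ ⟂ₘ ν := by
  have hinv := hμ.toMeasurePreserving.withDensity_rnDeriv hν.toMeasurePreserving
  obtain ⟨c, hc⟩ := hν.eq_smul_of_absolutelyContinuous hinv (withDensity_absolutelyContinuous _ _)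
  rcases eq_or_ne c 0 with rfl | hc0
  · right
    have hsum := Measure.singularPart_add_rnDeriv μ ν
    rw [hc, zero_smul, add_zero] at hsum
    rw [← hsum]
    exact Measure.mutuallySingular_singularPart μ ν
  · left
    have hle : ν ≪ μ := by
      refine (Measure.absolutelyContinuous_smul hc0).trans ?_
      rw [← hc]
      exact (Measure.withDensity_rnDeriv_le μ ν).absolutelyContinuous
    exact (hμ.eq_of_absolutelyContinuous hν.toMeasurePreserving hle).symm

namespace DegreeJoining

/-! ### Doubly transitive points are typical -/

section Typical

variable {B : Type*} [TopologicalSpace B] {Y : Subshift B ℤ}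

theorem continuous_shiftMap : Continuous (shiftMap Y) :=
  ((continuous_shift 1).comp continuous_subtype_val).subtype_mk _

theorem occursAt_shift {B : Type*} {w : List B} {x : ℤ → B} {i g : ℤ} :
    OccursAt w (shift g x) i ↔ OccursAt w x (i + g) := by
  refine forall₂_congr fun j hj => ?_
  rw [shift_apply, show g + (i + (j : ℤ)) = i + g + j by ring]

theorem isOpen_setOf_occursAt [DiscreteTopology B] (w : List B) (i : ℤ) :
    IsOpen {y : Y.carrier | OccursAt w y.1 i} := by
  have hset : {y : Y.carrier | OccursAt w y.1 i} =
      ⋂ j : Fin w.length, {y : Y.carrier | y.1 (i + (j : ℕ)) = w[j]} := by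
    ext y
    simp only [OccursAt, Set.mem_ofPred_eq, Set.mem_iInter]
    exact ⟨fun h j => h j j.2, fun h j hj => h ⟨j, hj⟩⟩
  rw [hset]
  refine isOpen_iInter_of_finite fun j => ?_
  have hcont : Continuous fun y : Y.carrier => y.1 (i + ((j : ℕ) : ℤ)) :=
    (continuous_apply _).comp continuous_subtype_val
  exact (isOpen_discrete {w[j]}).preimage hcont

/-- A word of the language occurs at any prescribed coordinate of some point. -/
theorem exists_occursAt {w : List B} (hw : w ∈ language Y) (N : ℤ) :
    ∃ y : Y.carrier, OccursAt w y.1 N := by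
  obtain ⟨x, hx, i, hi⟩ := hw
  refine ⟨⟨shift (i - N) x, Y.mapsTo _ hx⟩, ?_⟩
  rw [occursAt_shift, add_sub_cancel]
  exact hi

variable [Finite B] [DiscreteTopology B] [MeasurableSpace B] [BorelSpace B]
  {ν : Measure Y.carrier} [IsProbabilityMeasure ν] [ν.IsOpenPosMeasure]

/-- For an ergodic measure of full support, almost every point is doubly transitive. The sets
"`w` occurs at some coordinate `≥ N`" and "`w` occurs at some coordinate `≤ N`" are open, nonempty
and mapped into themselves by the shift or its inverse, so they have full measure. -/
theorem ae_isDoublyTransitive (hν : Ergodic (shiftMap Y) ν) :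
    ∀ᵐ y ∂ν, IsDoublyTransitive y := by
  simp only [IsDoublyTransitive]
  refine ae_all_iff.2 fun w => ?_
  by_cases hw : w ∈ language Y
  swap
  · exact .of_forall fun y h => absurd h hw
  simp only [hw, forall_true_left]
  refine ae_all_iff.2 fun N => ?_
  have hfull : ∀ s : Set Y.carrier, IsOpen s → (∃ y, y ∈ s) →
      (s =ᵐ[ν] (∅ : Set Y.carrier) ∨ s =ᵐ[ν] Set.univ) → ∀ᵐ y ∂ν, y ∈ s := by
    rintro s hs hne (h | h)
    · exact absurd (ae_eq_empty.1 h) (hs.measure_pos ν hne).ne'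
    · exact Filter.eventuallyEq_univ.1 h
  have hR : IsOpen {y : Y.carrier | ∃ i ≥ N, OccursAt w y.1 i} := by
    have : {y : Y.carrier | ∃ i ≥ N, OccursAt w y.1 i} =
        ⋃ i ≥ N, {y : Y.carrier | OccursAt w y.1 i} := by ext; simp
    rw [this]
    exact isOpen_biUnion fun i _ => isOpen_setOf_occursAt w i
  have hL : IsOpen {y : Y.carrier | ∃ i ≤ N, OccursAt w y.1 i} := by
    have : {y : Y.carrier | ∃ i ≤ N, OccursAt w y.1 i} =
        ⋃ i ≤ N, {y : Y.carrier | OccursAt w y.1 i} := by ext; simp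
    rw [this]
    exact isOpen_biUnion fun i _ => isOpen_setOf_occursAt w i
  obtain ⟨y₀, hy₀⟩ := exists_occursAt hw N
  refine (hfull _ hR ⟨y₀, N, le_rfl, hy₀⟩ ?_).and (hfull _ hL ⟨y₀, N, le_rfl, hy₀⟩ ?_)
  · refine hν.ae_empty_or_univ_of_preimage_ae_le hR.measurableSet.nullMeasurableSet
      (Filter.Eventually.of_forall ?_)
    rintro y ⟨i, hi, h⟩
    exact ⟨i + 1, by lia, occursAt_shift.1 h⟩
  · refine hν.ae_empty_or_univ_of_ae_le_preimage hL.measurableSet.nullMeasurableSet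
      (Filter.Eventually.of_forall ?_)
    rintro y ⟨i, hi, h⟩
    refine ⟨i - 1, by lia, occursAt_shift.2 ?_⟩
    rwa [sub_add_cancel]

end Typical

/-! ### Relative joinings -/

section Joinings

theorem measurable_coordMap {X : Type*} [MeasurableSpace X] {n d : ℕ} (f : Fin n → Fin d) :
    Measurable (coordMap (X := X) f) :=
  measurable_pi_lambda _ fun i => measurable_pi_apply (f i)

variable {X Y : Type*} [MeasurableSpace X] [MeasurableSpace Y] {T : X → X} {π : X → Y}
  {ν : Measure Y} {n d : ℕ} {lam : Measure (Fin d → X)} {lam' : Measure (Fin n → X)}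

theorem IsRelativeJoining.exists_measurePreserving (h : IsRelativeJoining T π ν lam)
    (hπ : Measurable π) : ∃ i : Fin d, MeasurePreserving (fun x => π (x i)) lam ν := by
  obtain ⟨i, hi⟩ := h.image
  refine ⟨i, hπ.comp (measurable_pi_apply i), ?_⟩
  rw [← hi, Measure.map_map hπ (measurable_pi_apply i)]
  rfl

theorem ergodic_map_coordMap (hlam : Ergodic (powMap T d) lam) (hT : Measurable T)
    (f : Fin n → Fin d) : Ergodic (powMap T n) (lam.map (coordMap f)) :=
  ((measurable_coordMap f).measurePreserving lam).ergodic_of_ergodic_semiconj hlam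
    (measurable_pi_lambda _ fun i => hT.comp (measurable_pi_apply i)) fun _ => rfl

/-- If almost every tuple of the relative joining `lam` exhausts the fibre through its entries, then
every relative joining over `ν` is absolutely continuous with respect to the sum of the images
`p_f lam`. -/
theorem IsRelativeJoining.absolutelyContinuous_sum_map_coordMap
    [TopologicalSpace X] [PolishSpace X] [BorelSpace X]
    [TopologicalSpace Y] [T2Space Y] [BorelSpace Y]
    (hπ : Continuous π) (hlam : IsRelativeJoining T π ν lam)
    (hrange : ∀ᵐ x ∂lam, ∀ i, π ⁻¹' {π (x i)} ⊆ Set.range x)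
    (hlam' : IsRelativeJoining T π ν lam') :
    lam' ≪ Measure.sum fun f : Fin n → Fin d => lam.map (coordMap f) := by
  have := hlam.prob
  have := hlam'.prob
  obtain ⟨i, hi⟩ := hlam.exists_measurePreserving hπ.measurable
  obtain ⟨j, hj⟩ := hlam'.exists_measurePreserving hπ.measurable
  refine Measure.AbsolutelyContinuous.mk fun s hs hs0 => ?_
  rw [Measure.sum_apply _ hs, ENNReal.tsum_eq_zero] at hs0
  have hgood : ∀ᵐ x ∂lam, π ⁻¹' {π (x i)} ⊆ Set.range x ∧
      ∀ f : Fin n → Fin d, coordMap f x ∉ s := by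
    refine (hrange.mono fun x hx => hx i).and (ae_all_iff.2 fun f => ?_)
    have h0 := hs0 f
    rw [Measure.map_apply (measurable_coordMap f) hs] at h0
    exact measure_eq_zero_iff_ae_notMem.1 h0
  obtain ⟨S, hSsub, hSmeas, hSnull⟩ := exists_measurable_superset_of_null (ae_iff.1 hgood)
  have hScompl : lam Sᶜ = 1 := (prob_compl_eq_one_iff hSmeas).2 hSnull
  refine nonpos_iff_eq_zero.1 (ENNReal.le_of_forall_pos_le_add fun ε hε _ => ?_)
  rw [zero_add]
  obtain ⟨K, hKS, hK, hKε⟩ := hSmeas.compl.exists_isCompact_lt_add (μ := lam)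
    (measure_ne_top _ _) (ENNReal.coe_ne_zero.2 hε.ne')
  have hq : Continuous fun x : Fin d → X => π (x i) := hπ.comp (continuous_apply i)
  -- The good points of `Y`, up to measure `ε`: no tuple in a fibre over `C` lies in `s`.
  set C : Set Y := (fun x => π (x i)) '' K with hC
  have hCmeas : MeasurableSet C := (hK.image hq).measurableSet
  have hνC : ν Cᶜ ≤ ε := by
    have : IsProbabilityMeasure ν := 
      hi.map_eq ▸ Measure.isProbabilityMeasure_map hi.measurable.aemeasurable
    rw [prob_compl_eq_one_sub hCmeas, tsub_le_iff_left, ← hScompl]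
    refine hKε.le.trans (add_le_add_left ?_ _)
    rw [← hi.measure_preimage hCmeas.nullMeasurableSet]
    exact measure_mono (Set.subset_preimage_image _ _)
  refine le_trans ?_ hνC
  rw [← hj.measure_preimage hCmeas.compl.nullMeasurableSet]
  refine measure_mono_ae ?_
  filter_upwards [hlam'.fiber] with x' hx' hx's
  rintro ⟨x, hxK, hxx'⟩
  obtain ⟨hxrange, hxs⟩ := not_not.1 fun h => hKS hxK (hSsub h)
  have hmem : ∀ k, ∃ l, x l = x' k := fun k => hxrange ((hx' k j).trans hxx'.symm)
  choose f hf using hmem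
  exact hxs f (by rwa [show coordMap f x = x' from funext hf])

/-- An ergodic relative joining over `ν` is the image `p_f lam` of any ergodic relative joining
`lam` over `ν` whose tuples almost surely exhaust the fibre through their entries. -/
theorem IsRelativeJoining.exists_eq_map_coordMap
    [TopologicalSpace X] [PolishSpace X] [BorelSpace X]
    [TopologicalSpace Y] [T2Space Y] [BorelSpace Y]
    (hT : Measurable T) (hπ : Continuous π) (hlam : IsRelativeJoining T π ν lam)
    (herg : Ergodic (powMap T d) lam)
    (hrange : ∀ᵐ x ∂lam, ∀ i, π ⁻¹' {π (x i)} ⊆ Set.range x)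
    (hlam' : IsRelativeJoining T π ν lam') (herg' : Ergodic (powMap T n) lam') :
    ∃ f : Fin n → Fin d, lam' = lam.map (coordMap f) := by
  have := hlam.prob
  have := hlam'.prob
  by_contra! hne
  have hsing : ∀ f : Fin n → Fin d, lam' ⟂ₘ lam.map (coordMap f) := fun f => by
    have := Measure.isProbabilityMeasure_map (μ := lam) (measurable_coordMap f).aemeasurable
    exact (herg'.eq_or_mutuallySingular (ergodic_map_coordMap herg hT f)).resolve_left (hne f)
  have hac := hlam.absolutelyContinuous_sum_map_coordMap hπ hrange hlam'
  exact IsProbabilityMeasure.ne_zero lam'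
    (Measure.eq_zero_of_absolutelyContinuous_of_mutuallySingular hac
      (Measure.MutuallySingular.sum_right.2 hsing))

end Joinings

/-! ### Degree joinings -/

section Degree

variable {A B : Type*} [TopologicalSpace A] [TopologicalSpace B]
  [MeasurableSpace A] [MeasurableSpace B] {X : Subshift A ℤ} {Y : Subshift B ℤ}
  {π : X.carrier → Y.carrier} {ν : Measure Y.carrier}
  {lam : Measure (Fin (degree π) → X.carrier)}

/-- The defining property of the degree: doubly transitive points have exactly `degree π` preimages.
A degree joining has at least one coordinate, so `degree π` is nonzero; this excludes the value `0`
that `sInf` takes on the empty set, and the infimum in the definition is attained. -/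
theorem IsDegreeJoining.encard_fiber (h : IsDegreeJoining π ν lam) {y : Y.carrier}
    (hy : IsDoublyTransitive y) : (π ⁻¹' {y}).encard = degree π := by
  obtain ⟨i, -⟩ := h.joining.image
  have hpos : 0 < degree π := i.pos
  exact Nat.sInf_mem (Nat.nonempty_of_pos_sInf hpos) y hy

variable [Finite B] [DiscreteTopology B] [BorelSpace B]
  [IsProbabilityMeasure ν] [ν.IsOpenPosMeasure]

/-- Almost every tuple of a degree joining exhausts the fibre through its entries: its `degree π`
distinct entries lie in a fibre which has exactly `degree π` points. -/
theorem IsDegreeJoining.ae_fiber_subset_range (h : IsDegreeJoining π ν lam)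
    (hπ : Measurable π) (hν : Ergodic (shiftMap Y) ν) :
    ∀ᵐ x ∂lam, ∀ i, π ⁻¹' {π (x i)} ⊆ Set.range x := by
  obtain ⟨j, hj⟩ := h.joining.exists_measurePreserving hπ
  filter_upwards [h.separating, h.joining.fiber,
    hj.quasiMeasurePreserving.ae (ae_isDoublyTransitive hν)] with x hinj hfib hdt i
  have hsub : Set.range x ⊆ π ⁻¹' {π (x i)} := by
    rintro _ ⟨k, rfl⟩
    exact hfib k i
  have hcard : (π ⁻¹' {π (x i)}).encard = degree π := by
    rw [hfib i j]
    exact h.encard_fiber hdt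
  refine ((Set.finite_range x).eq_of_subset_of_encard_le hsub ?_).superset
  rw [hcard, ← Set.image_univ, hinj.encard_image, Set.encard_univ]
  simp

end Degree

end DegreeJoining

theorem mainTheorem3 {A B : Type*}
    [Finite A] [TopologicalSpace A] [DiscreteTopology A] [MeasurableSpace A] [BorelSpace A]
    [Finite B] [TopologicalSpace B] [DiscreteTopology B] [MeasurableSpace B] [BorelSpace B]
    (X : Subshift A ℤ) (Y : Subshift B ℤ)
    (hXsofic : DegreeJoining.IsSofic X) (hXirr : DegreeJoining.IsIrreducible X)
    (π : X.carrier → Y.carrier)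
    (hπ : DegreeJoining.IsFactorCode π) (hfin : DegreeJoining.IsFiniteToOne π)
    (ν : Measure Y.carrier) [IsProbabilityMeasure ν] [ν.IsOpenPosMeasure]
    (hν : Ergodic (DegreeJoining.shiftMap Y) ν) :
    (∀ lam : Measure (Fin (DegreeJoining.degree π) → X.carrier),
      DegreeJoining.IsDegreeJoining π ν lam →
      ∀ (n : ℕ) (lam' : Measure (Fin n → X.carrier)),
        DegreeJoining.IsRelativeJoining (DegreeJoining.shiftMap X) π ν lam' →
        Ergodic (DegreeJoining.powMap (DegreeJoining.shiftMap X) n) lam' →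
        ∃ f : Fin n → Fin (DegreeJoining.degree π),
          lam' = lam.map (DegreeJoining.coordMap f)) ∧
    (∀ lam lam' : Measure (Fin (DegreeJoining.degree π) → X.carrier),
      DegreeJoining.IsDegreeJoining π ν lam → DegreeJoining.IsDegreeJoining π ν lam' →
      ∃ f : Equiv.Perm (Fin (DegreeJoining.degree π)),
        lam' = lam.map (DegreeJoining.coordMap f)) := by
  -- The finite discrete alphabet is a Polish space, hence so are its countable power and `X`.
  have : SecondCountableTopology A := inferInstance
  have : TopologicalSpace.IsCompletelyMetrizableSpace A := inferInstance
  have : PolishSpace X.carrier := X.isClosed.polishSpace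
  have hpart : ∀ lam : Measure (Fin (DegreeJoining.degree π) → X.carrier),
      DegreeJoining.IsDegreeJoining π ν lam →
      ∀ (n : ℕ) (lam' : Measure (Fin n → X.carrier)),
        DegreeJoining.IsRelativeJoining (DegreeJoining.shiftMap X) π ν lam' →
        Ergodic (DegreeJoining.powMap (DegreeJoining.shiftMap X) n) lam' →
        ∃ f : Fin n → Fin (DegreeJoining.degree π),
          lam' = lam.map (DegreeJoining.coordMap f) :=
    fun lam hlam n lam' hlam' herg' =>
      hlam.joining.exists_eq_map_coordMap DegreeJoining.continuous_shiftMap.measurable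
        hπ.continuous hlam.ergodic (hlam.ae_fiber_subset_range hπ.continuous.measurable hν)
        hlam' herg'
  refine ⟨hpart, fun lam lam' hlam hlam' => ?_⟩
  obtain ⟨f, hf⟩ := hpart lam hlam _ lam' hlam'.joining hlam'.ergodic
  have := hlam.joining.prob
  have hsep : ∀ᵐ x ∂lam, Function.Injective (DegreeJoining.coordMap f x) :=
    ae_of_ae_map (DegreeJoining.measurable_coordMap f).aemeasurable (hf ▸ hlam'.separating)
  obtain ⟨x, hx⟩ := hsep.exists
  have hinj : Function.Injective f := fun i j hij => hx (congrArg x hij)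
  exact ⟨Equiv.ofBijective f (Finite.injective_iff_bijective.1 hinj), hf⟩
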